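/- Let $X\subseteq\mathbb R^d$ be a Borel set at each of whose points derivatives of functions given on $X$ are unique, i.e. the tangent directions of $X$ at the point span $\mathbb R^d$ (e.g. an open set, or the closure of a Lipschitz domain). Derivatives are taken within $X$, and a function is $C^n$ on a set if it agrees there with a $C^n$ function on an open neighbourhood of that set. Let $p,q$ be probability densities on $X$ that are $C^1$ and strictly positive on $X$. Put $s_p=\nabla p/p$, $s_q=\nabla q/q$, and $\mathcal A_r f=s_r f+\nabla f$ for $r\in\{p,q\}$. A function $f$ on $X$ is in the Stein class of $p$ if $f$ is $C^1$ on $X$ and $\nabla(fp)$ is integrable over $X$ with $\int_X\nabla(f p)\,dx=0$. A kernel $k$ is in the Stein class of $p$ if $k$ is $C^2$ on $X\times X$ and, for every $x\in X$, $k(x,\cdot)$ and $k(\cdot,x)$ are in the Stein class of $p$. A positive definite kernel on $X$ is a symmetric $k$ with $\sum_{i,j}c_ic_jk(x_i,x_j)\ge 0$ for all finite families $x_i\in X$, $c_i\in\mathbb R$. Write $$u_q(x,x')=s_q(x)^\top k(x,x')s_q(x')+s_q(x)^\top\nabla_{x'}k(x,x')+\nabla_xk(x,x')^\top s_q(x')+\operatorname{trace}(\nabla_{x,x'}k(x,x')),$$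 $$S(p,q)=\mathbb E_{x,x'\sim p}\big[(s_q(x)-s_p(x))^\top k(x,x')(s_q(x')-s_p(x'))\big],$$ with $x,x'$ independent draws from $p$. Let $k$ be a positive definite kernel on $X$ in the Stein class of $p$, with positive eigenvalues $\lambda_j$ and eigenfunctions $e_j$ ($j$ in a countable index set) that are orthonormal in $L^2(X,dx)$: $\int_X k(x,x')e_j(x')\,dx'=\lambda_je_j(x)$ for all $x\in X$ (the integral converging absolutely), and $k(x,x')=\sum_j\lambda_je_j(x)e_j(x')$ for all $x,x'\in X$. Then every $e_j$ is differentiable on $X$, $$u_q(x,x')=\sum_j\lambda_j\,[\mathcal A_qe_j(x)]^\top[\mathcal A_qe_j(x')]\qquad\text{for all }x,x'\in X,$$ and $u_q$ is a positive definite kernel on $X$. If moreover, for both $r=p$ and $r=q$, the functions $\lambda_j\|\mathcal A_re_j(x)\|_2\,\|\mathcal A_re_j(x')\|_2$ are absolutely integrable with respect to the sum over $j$ and independent $x,x'\sim p$, i.e. $\mathbb E_{p}\|\mathcal A_re_j\|_2<\infty$ for all $j$ and $\sum_j\lambda_j(\mathbb E_{p}\|\mathcal A_re_j\|_2)^2<\infty$,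 then the expectation defining $S(p,q)$ converges absolutely and $$S(p,q)=\sum_j\lambda_j\,\big\|\mathbb E_{x\sim p}[\mathcal A_qe_j(x)]\big\|_2^2 .$$ -/

import Mathlib

open MeasureTheory

noncomputable section

namespace KernelStein

variable {d : ℕ}

/-- `f` is of class `C^n` on the (arbitrary) set `s`: it agrees on `s` with a function that is
of class `C^n` on an open set containing `s`. For open `s` this is the usual notion. -/
def SmoothOn {V : Type*} [NormedAddCommGroup V] [NormedSpace ℝ V]
    (n : ℕ) (f : V → ℝ) (s : Set V) : Prop :=
  ∃ U : Set V, IsOpen U ∧ s ⊆ U ∧ ∃ g : V → ℝ, ContDiffOn ℝ n g U ∧ Set.EqOn f g s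

/-- Domains `X ⊆ ℝ^d` on which integration and differentiation make sense: Borel sets at each of
whose points the derivative of a function given on `X` only is unique (for instance open sets,
convex sets with nonempty interior, closures of Lipschitz domains). -/
structure IsDomainSet (X : Set (EuclideanSpace ℝ (Fin d))) : Prop where
  measurableSet : MeasurableSet X
  uniqueDiffOn : UniqueDiffOn ℝ X

/-- `p` is a smooth (that is, continuously differentiable) probability density
supported on `X`. -/
structure IsSmoothDensity (X : Set (EuclideanSpace ℝ (Fin d)))
    (p : EuclideanSpace ℝ (Fin d) → ℝ) : Prop where
  smooth : SmoothOn 1 p X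
  pos : ∀ x ∈ X, 0 < p x
  integral_eq_one : ∫ x in X, p x = 1

/-- The probability measure on `X` with density `p`. -/
def law (X : Set (EuclideanSpace ℝ (Fin d))) (p : EuclideanSpace ℝ (Fin d) → ℝ) :
    Measure (EuclideanSpace ℝ (Fin d)) :=
  (volume.restrict X).withDensity fun x => ENNReal.ofReal (p x)

/-- The score function `s_p = ∇ log p = ∇p / p`. -/
def score (X : Set (EuclideanSpace ℝ (Fin d))) (p : EuclideanSpace ℝ (Fin d) → ℝ)
    (x : EuclideanSpace ℝ (Fin d)) : EuclideanSpace ℝ (Fin d) :=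
  (p x)⁻¹ • gradientWithin p X x

/-- The Stein operator `A_p f = s_p f + ∇f`. -/
def steinOp (X : Set (EuclideanSpace ℝ (Fin d))) (p f : EuclideanSpace ℝ (Fin d) → ℝ)
    (x : EuclideanSpace ℝ (Fin d)) : EuclideanSpace ℝ (Fin d) :=
  f x • score X p x + gradientWithin f X x

/-- `f` is in the Stein class of `p`: it is smooth (continuously differentiable) on `X`, and
`∇(f p)` is integrable over `X` with integral zero. -/
structure InSteinClass (X : Set (EuclideanSpace ℝ (Fin d)))
    (p f : EuclideanSpace ℝ (Fin d) → ℝ) : Prop where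
  smooth : SmoothOn 1 f X
  integrableOn : IntegrableOn (gradientWithin (fun x => f x * p x) X) X
  integral_eq_zero : ∫ x in X, gradientWithin (fun x => f x * p x) X x = 0

/-- The kernel `k` is in the Stein class of `p`: it is of class `C^2` on `X × X`, and all its
sections `k(x, ·)` and `k(·, x)` are in the Stein class of `p`. -/
structure KernelInSteinClass (X : Set (EuclideanSpace ℝ (Fin d)))
    (p : EuclideanSpace ℝ (Fin d) → ℝ)
    (k : EuclideanSpace ℝ (Fin d) → EuclideanSpace ℝ (Fin d) → ℝ) : Prop where
  smooth : SmoothOn 2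
    (fun z : EuclideanSpace ℝ (Fin d) × EuclideanSpace ℝ (Fin d) => k z.1 z.2) (X ×ˢ X)
  left : ∀ x ∈ X, InSteinClass X p (fun x' => k x x')
  right : ∀ x ∈ X, InSteinClass X p (fun x' => k x' x)

/-- Positive definite kernels on `X`: symmetric, with `∑ cᵢ cⱼ k(xᵢ, xⱼ) ≥ 0` for all finite
families of points of `X` and real coefficients. -/
def IsPosDefKernel (X : Set (EuclideanSpace ℝ (Fin d)))
    (k : EuclideanSpace ℝ (Fin d) → EuclideanSpace ℝ (Fin d) → ℝ) : Prop :=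
  (Matrix.of fun x x' : X => k x x').PosSemidef

/-- The `lam j` are the positive eigenvalues and the `e j` the corresponding eigenfunctions,
orthonormal in `L²(X, dx)`, of the kernel `k`, and `k(x, x') = ∑ⱼ lam j * e j x * e j x'`. -/
structure IsSpectralDecomposition {ι : Type*} (X : Set (EuclideanSpace ℝ (Fin d)))
    (k : EuclideanSpace ℝ (Fin d) → EuclideanSpace ℝ (Fin d) → ℝ)
    (lam : ι → ℝ) (e : ι → EuclideanSpace ℝ (Fin d) → ℝ) : Prop where
  pos : ∀ j, 0 < lam j
  memLp : ∀ j, MemLp (e j) 2 (volume.restrict X)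
  integral_sq : ∀ j, ∫ x in X, e j x * e j x = 1
  integral_mul : ∀ i j, i ≠ j → ∫ x in X, e i x * e j x = 0
  eigen_integrable : ∀ j, ∀ x ∈ X, IntegrableOn (fun x' => k x x' * e j x') X
  eigen : ∀ j, ∀ x ∈ X, ∫ x' in X, k x x' * e j x' = lam j * e j x
  expansion : ∀ x ∈ X, ∀ x' ∈ X, HasSum (fun j => lam j * e j x * e j x') (k x x')

/-- The function `u_q(x, x') = s_q(x)ᵀ k(x,x') s_q(x') + s_q(x)ᵀ ∇_{x'} k(x,x')
+ ∇_x k(x,x')ᵀ s_q(x') + trace (∇_{x,x'} k(x,x'))`. -/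
def steinKernel (X : Set (EuclideanSpace ℝ (Fin d))) (q : EuclideanSpace ℝ (Fin d) → ℝ)
    (k : EuclideanSpace ℝ (Fin d) → EuclideanSpace ℝ (Fin d) → ℝ)
    (x x' : EuclideanSpace ℝ (Fin d)) : ℝ :=
  inner ℝ (score X q x) (k x x' • score X q x')
    + inner ℝ (score X q x) (gradientWithin (fun y' => k x y') X x')
    + inner ℝ (gradientWithin (fun y => k y x') X x) (score X q x')
    + ∑ i : Fin d, gradientWithin (fun y => gradientWithin (fun y' => k y y') X x' i) X x i

/-- The integrand `δ(x)ᵀ k(x,x') δ(x')`, `δ = s_q - s_p`, of the kernelized Stein discrepancy. -/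
def ksdIntegrand (X : Set (EuclideanSpace ℝ (Fin d))) (p q : EuclideanSpace ℝ (Fin d) → ℝ)
    (k : EuclideanSpace ℝ (Fin d) → EuclideanSpace ℝ (Fin d) → ℝ)
    (z : EuclideanSpace ℝ (Fin d) × EuclideanSpace ℝ (Fin d)) : ℝ :=
  inner ℝ (score X q z.1 - score X p z.1) (k z.1 z.2 • (score X q z.2 - score X p z.2))

/-- The kernelized Stein discrepancy `S(p,q) = E_{x,x'∼p} [δ(x)ᵀ k(x,x') δ(x')]`,
with `x, x'` independent draws from `p`. -/
def ksd (X : Set (EuclideanSpace ℝ (Fin d))) (p q : EuclideanSpace ℝ (Fin d) → ℝ)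
    (k : EuclideanSpace ℝ (Fin d) → EuclideanSpace ℝ (Fin d) → ℝ) : ℝ :=
  ∫ z, ksdIntegrand X p q k z ∂((law X p).prod (law X p))

/-- Absolute integrability, with respect to the sum over `j` and the expectation over independent
`x, x' ∼ p`, of `lam j ‖A_r (e j) (x)‖ ‖A_r (e j) (x')‖`, where `A_r` is the Stein operator
of `r`. -/
structure SteinSummable {ι : Type*} (X : Set (EuclideanSpace ℝ (Fin d)))
    (p r : EuclideanSpace ℝ (Fin d) → ℝ)
    (lam : ι → ℝ) (e : ι → EuclideanSpace ℝ (Fin d) → ℝ) : Prop where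
  integrable : ∀ j, Integrable (steinOp X r (e j)) (law X p)
  summable : Summable fun j => lam j * (∫ x, ‖steinOp X r (e j) x‖ ∂(law X p)) ^ 2

end KernelStein

end

/-!
Write `Φ x = (√(lam j) * e j x)ⱼ`, a vector of `ℓ²(ι)` for `x ∈ X`. The expansion of the kernel says
`⟪Φ x, Φ y⟫ = k x y`, so all assertions can be read off this feature map once it is known to be
differentiable within `X`.

*Differentiability.* Since `k` is the restriction of a `C²` function, its second mixed difference at
`(x, x)` is `B (y - x) (z - x) + o(‖y - x‖ ‖z - x‖)` with `B` a bilinear form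
(`exists_isLittleO_mixedDifference`), and this mixed difference is `⟪Φ y - Φ x, Φ z - Φ x⟫`. Hence
difference quotients of `Φ` along a family of increments realizing a tangent direction of `X` are
Cauchy in `ℓ²`, and converge by completeness
(`exists_inner_isLittleO_of_mem_tangentConeAt`). As the tangent directions span, the limits
determine a linear map `L` with `⟪L u, L v⟫ = B u v`; expanding `‖Φ y - Φ x - L (y - x)‖²` shows
that `L` is the derivative (`differentiableWithinAt_of_inner_isLittleO`).

*The Stein kernel.* With `Ψᵢ = s_q,ᵢ Φ + ∂ᵢΦ` (`steinFeature`), the Stein operator of `⟪c, Φ ·⟫` has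
`i`-th coordinate `⟪c, Ψᵢ ·⟫`, and `u_q(x, x') = ∑ᵢ ⟪Ψᵢ x, Ψᵢ x'⟫`. The `j`-th coordinate of `Ψᵢ x`
is `√(lam j) * (A_q e_j x)ᵢ`, which gives the series for `u_q`; positive definiteness is that of
Gram matrices.

*The Stein identity `m_j := E_p[A_p e_j] = 0`* (`integral_steinOp_eigenfunction_eq_zero`). Fix a
coordinate `i` and put `c_j = √(lam j) * m_{j,i}`, which is square summable. Integrating the series
of `A_p k(x', ·)` term by term, the Stein class hypothesis on `k(x', ·)` reads `⟪c, Φ x'⟫ = 0` for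
all `x' ∈ X`. Differentiating, `⟪c, Ψᵢ x⟫ = 0` on `X`, and integrating this series in turn against
`p` gives `∑ⱼ lam j * m_{j,i}² = 0`.

*The discrepancy.* Since `A_q f - A_p f = f (s_q - s_p)`, the integrand of `S(p, q)` is the series
of `lam j * ⟪(A_q - A_p) e_j (x), (A_q - A_p) e_j (x')⟫`; it is integrated term by term, and
`A_p e_j` drops out by the Stein identity.
-/

namespace KernelStein

open Filter Asymptotics Topology

/-! ### Differentiability of maps into a Hilbert space with a smooth kernel -/

section Differentiability

variable {E H : Type*} [NormedAddCommGroup E] [NormedSpace ℝ E]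
  [NormedAddCommGroup H] [InnerProductSpace ℝ H]

/-- The second mixed difference of a `C²` function at a point of the diagonal is bilinear up to an
error that is small relative to the product of the two increments. (A second order Taylor expansion
would only give an error relative to the square of the larger one.) -/
theorem exists_isLittleO_mixedDifference {K : E × E → ℝ} {x : E} (hK : ContDiffAt ℝ 2 K (x, x)) :
    ∃ B : E →L[ℝ] E →L[ℝ] ℝ,
      (fun z : E × E => K (z.1, z.2) - K (z.1, x) - K (x, z.2) + K (x, x) - B (z.1 - x) (z.2 - x))
        =o[𝓝 (x, x)] fun z => ‖z.1 - x‖ * ‖z.2 - x‖ := by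
  set A := fderiv ℝ (fderiv ℝ K) (x, x)
  have hA' : HasStrictFDerivAt (fderiv ℝ K) A (x, x) :=
    (hK.fderiv_right (m := 1) (by norm_num)).hasStrictFDerivAt (by norm_num)
  let B : E →L[ℝ] E →L[ℝ] ℝ :=
    ((ContinuousLinearMap.compL ℝ E (E × E) ℝ).flip (ContinuousLinearMap.inl ℝ E E) ∘L A ∘L
      ContinuousLinearMap.inr ℝ E E).flip
  have hB : ∀ u v, B u v = A (0, v) (u, 0) := fun u v => by simp [B]
  refine ⟨B, isLittleO_iff.2 fun ε hε => ?_⟩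
  have hdiff : ∀ᶠ z in 𝓝 (x, x), DifferentiableAt ℝ K z := by
    filter_upwards [hK.eventually (by simp)] with z hz
    exact hz.differentiableAt (by norm_num)
  have hlip : ∀ᶠ w : (E × E) × (E × E) in 𝓝 ((x, x), (x, x)),
      ‖fderiv ℝ K w.1 - fderiv ℝ K w.2 - A (w.1 - w.2)‖ ≤ ε * ‖w.1 - w.2‖ :=
    (hasStrictFDerivAt_iff_isLittleO.1 hA').def hε
  obtain ⟨δ₁, hδ₁, h₁⟩ := Metric.eventually_nhds_iff_ball.1 hdiff
  obtain ⟨δ₂, hδ₂, h₂⟩ := Metric.eventually_nhds_iff_ball.1 hlip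
  filter_upwards [Metric.ball_mem_nhds (x, x) (lt_min hδ₁ hδ₂)] with ⟨y, z⟩ hyz
  rw [← ball_prod_same] at hyz
  obtain ⟨hy, hz⟩ := hyz
  have hmem : ∀ u ∈ Metric.ball x (min δ₁ δ₂), ∀ v ∈ Metric.ball x (min δ₁ δ₂),
      (u, v) ∈ Metric.ball (x, x) δ₁ ∧ (u, v) ∈ Metric.ball (x, x) δ₂ := by
    intro u hu v hv
    have : (u, v) ∈ Metric.ball (x, x) (min δ₁ δ₂) := by
      rw [← ball_prod_same]; exact ⟨hu, hv⟩
    exact ⟨Metric.ball_subset_ball (min_le_left _ _) this,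
      Metric.ball_subset_ball (min_le_right _ _) this⟩
  have hx : x ∈ Metric.ball x (min δ₁ δ₂) := Metric.mem_ball_self (lt_min hδ₁ hδ₂)
  let inl := ContinuousLinearMap.inl ℝ E E
  -- The derivative in `u` of the mixed difference is small by strict differentiability of `K'`.
  have hder : ∀ u ∈ Metric.ball x (min δ₁ δ₂),
      HasFDerivWithinAt (fun u => K (u, z) - K (u, x) - B (u - x) (z - x))
        (fderiv ℝ K (u, z) ∘L inl - fderiv ℝ K (u, x) ∘L inl - B.flip (z - x))
        (Metric.ball x (min δ₁ δ₂)) u := by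
    intro u hu
    have e : ∀ v ∈ Metric.ball x (min δ₁ δ₂),
        HasFDerivAt (fun u => K (u, v)) (fderiv ℝ K (u, v) ∘L inl) u := fun v hv =>
      (h₁ _ (hmem u hu v hv).1).hasFDerivAt.comp u (hasFDerivAt_prodMk_left u v)
    have e₃ : HasFDerivAt (fun u => B (u - x) (z - x)) (B.flip (z - x)) u := by
      exact (B.flip (z - x)).hasFDerivAt.comp u ((hasFDerivAt_id u).sub_const x)
    exact (((e z hz).sub (e x hx)).sub e₃).hasFDerivWithinAt
  have hbound : ∀ u ∈ Metric.ball x (min δ₁ δ₂),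
      ‖fderiv ℝ K (u, z) ∘L inl - fderiv ℝ K (u, x) ∘L inl - B.flip (z - x)‖
        ≤ ε * ‖z - x‖ := by
    intro u hu
    have hw := h₂ ((u, z), (u, x)) (by
      rw [← ball_prod_same]; exact ⟨(hmem u hu z hz).2, (hmem u hu x hx).2⟩)
    have heq : fderiv ℝ K (u, z) ∘L inl - fderiv ℝ K (u, x) ∘L inl - B.flip (z - x)
        = (fderiv ℝ K (u, z) - fderiv ℝ K (u, x) - A ((u, z) - (u, x))) ∘L inl := by
      have h0 : ((u, z) - (u, x) : E × E) = (0, z - x) := by simp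
      rw [h0]
      ext v
      change _ - _ - B v (z - x) = _
      rw [hB]
      rfl
    rw [heq]
    calc _ ≤ ‖fderiv ℝ K (u, z) - fderiv ℝ K (u, x) - A ((u, z) - (u, x))‖ * ‖inl‖ :=
          ContinuousLinearMap.opNorm_comp_le _ _
      _ ≤ ‖fderiv ℝ K (u, z) - fderiv ℝ K (u, x) - A ((u, z) - (u, x))‖ * 1 := by
          gcongr
          exact ContinuousLinearMap.norm_inl_le_one ℝ E E
      _ ≤ ε * ‖z - x‖ := by
          refine (mul_one _).le.trans (hw.trans_eq ?_)
          simp [Prod.norm_def]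
  have := (convex_ball x (min δ₁ δ₂)).norm_image_sub_le_of_norm_hasFDerivWithin_le hder hbound
    hx hy
  simp only [sub_self, map_zero, zero_apply, sub_zero] at this
  calc _ = ‖K (y, z) - K (y, x) - B (y - x) (z - x) - (K (x, z) - K (x, x))‖ := by
        congr 1; ring
    _ ≤ ε * ‖z - x‖ * ‖y - x‖ := this
    _ = _ := by simp; ring

variable {X : Set E} {x : E} {Φ : E → H} {B : E →L[ℝ] E →L[ℝ] ℝ}

/-- If the inner products of increments of `Φ` at `x` are given by `B` to leading order, then `Φ`
has a derivative `w` in every tangent direction `v` of `X` at `x`. It is characterized here through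
inner products: against increments of `Φ` it acts as `B · v` to leading order, and against any `w'`
acting as `B · v'` it has inner product `B v v'`. -/
theorem exists_inner_isLittleO_of_mem_tangentConeAt [CompleteSpace H]
    (hΦ : (fun z : E × E => inner ℝ (Φ z.1 - Φ x) (Φ z.2 - Φ x) - B (z.1 - x) (z.2 - x))
        =o[𝓝[X] x ×ˢ 𝓝[X] x] fun z => ‖z.1 - x‖ * ‖z.2 - x‖)
    {v : E} (hv : v ∈ tangentConeAt ℝ X x) :
    ∃ w : H, (fun y => inner ℝ (Φ y - Φ x) w - B (y - x) v) =o[𝓝[X] x] (fun y => y - x) ∧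
      ∀ v' w', (fun y => inner ℝ (Φ y - Φ x) w' - B (y - x) v') =o[𝓝[X] x] (fun y => y - x) →
        inner ℝ w w' = B v v' := by
  obtain ⟨α, l, hl, c, δ, hδ, hδX, hcδ⟩ := exists_fun_of_mem_tangentConeAt hv
  have hlim : Tendsto (fun n => x + δ n) l (𝓝[X] x) :=
    tendsto_nhdsWithin_iff.2 ⟨by simpa using hδ.const_add x, hδX⟩
  set u : α → H := fun n => c n • (Φ (x + δ n) - Φ x) with hu
  have hO : (fun n => c n * ‖δ n‖) =O[l] (fun _ => (1 : ℝ)) := by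
    refine (isBigO_of_le l fun n => ?_).trans (hcδ.isBigO_one ℝ)
    simp [norm_smul]
  -- By the hypothesis on `Φ`, difference quotients have asymptotically constant inner products.
  have hpair : Tendsto (fun z : α × α => inner ℝ (u z.1) (u z.2)) (l ×ˢ l) (𝓝 (B v v)) := by
    have h₁ := hΦ.comp_tendsto (hlim.prodMap hlim)
    have h₂ := (isBigO_refl (fun z : α × α => c z.1 * c z.2) (l ×ˢ l)).mul_isLittleO h₁
    have h₃ : (fun z : α × α => c z.1 * ‖δ z.1‖ * (c z.2 * ‖δ z.2‖)) =O[l ×ˢ l]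
        (fun _ => (1 : ℝ) * 1) :=
      (hO.comp_tendsto tendsto_fst).mul (hO.comp_tendsto tendsto_snd)
    have h₄ : Tendsto (fun z : α × α => B (c z.1 • δ z.1) (c z.2 • δ z.2)) (l ×ˢ l)
        (𝓝 (B v v)) :=
      B.continuous₂.continuousAt.tendsto.comp (f := fun z : α × α => (c z.1 • δ z.1, c z.2 • δ z.2))
        ((hcδ.comp tendsto_fst).prodMk_nhds (hcδ.comp tendsto_snd))
    have h₅ := (h₂.trans_isBigO ((isBigO_of_le _ fun z => le_of_eq ?_).trans h₃)).trans_isBigO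
      (isBigO_of_le (g := fun _ => (1 : ℝ)) _ (by simp))
    · have h₆ := ((isLittleO_one_iff ℝ).1 h₅).add h₄
      rw [zero_add] at h₆
      refine h₆.congr fun z => ?_
      simp [hu, inner_smul_left, inner_smul_right]
      ring
    · simp
      ring
  have hcauchy : Cauchy (map u l) := by
    refine cauchy_map_iff.2 ⟨hl, tendsto_uniformity_iff_dist_tendsto_zero.2 ?_⟩
    have hd₁ := hpair.comp (tendsto_fst.prodMk tendsto_fst : Tendsto _ (l ×ˢ l) (l ×ˢ l))
    have hd₂ := hpair.comp (tendsto_snd.prodMk tendsto_snd : Tendsto _ (l ×ˢ l) (l ×ˢ l))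
    have h := (((hd₁.sub (hpair.const_mul 2)).add hd₂)).sqrt
    have h0 : B v v - 2 * B v v + B v v = 0 := by ring
    rw [h0, Real.sqrt_zero] at h
    refine h.congr fun z => ?_
    rw [dist_eq_norm, ← Real.sqrt_sq (norm_nonneg (u z.1 - u z.2)), norm_sub_sq_real]
    simp
  obtain ⟨w, hw⟩ := CompleteSpace.complete hcauchy
  replace hw : Tendsto u l (𝓝 w) := hw
  refine ⟨w, isLittleO_iff.2 fun ε hε => ?_, fun v' w' hw' => ?_⟩
  · -- The error bound is uniform in the second increment, so it survives the limit along `l`.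
    have hε' : 0 < ε / (‖v‖ + 1) := by positivity
    filter_upwards [(hΦ.def hε').curry] with y hy
    have hev := hlim.eventually hy
    have hle : ‖inner ℝ (Φ y - Φ x) w - B (y - x) v‖ ≤ ε / (‖v‖ + 1) * (‖y - x‖ * ‖v‖) := by
      have hleft : Tendsto (fun n => ‖inner ℝ (Φ y - Φ x) (u n) - B (y - x) (c n • δ n)‖) l
          (𝓝 ‖inner ℝ (Φ y - Φ x) w - B (y - x) v‖) :=
        ((tendsto_const_nhds.inner hw).sub (((B (y - x)).continuous.tendsto v).comp hcδ)).norm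
      refine le_of_tendsto_of_tendsto hleft
        ((hcδ.norm.const_mul ‖y - x‖).const_mul (ε / (‖v‖ + 1))) ?_
      filter_upwards [hev] with n hn
      have : inner ℝ (Φ y - Φ x) (u n) - B (y - x) (c n • δ n)
          = c n * (inner ℝ (Φ y - Φ x) (Φ (x + δ n) - Φ x) - B (y - x) (x + δ n - x)) := by
        simp [hu, inner_smul_right]; ring
      rw [this, norm_mul, norm_smul]
      calc _ ≤ ‖c n‖ * (ε / (‖v‖ + 1) * ‖‖y - x‖ * ‖x + δ n - x‖‖) := by gcongr
        _ = _ := by simp; ring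
    refine hle.trans ?_
    calc _ = ε * ‖y - x‖ * (‖v‖ / (‖v‖ + 1)) := by ring
      _ ≤ ε * ‖y - x‖ * 1 := by
          gcongr
          exact div_le_one_of_le₀ (by linarith) (by positivity)
      _ = _ := mul_one _
  · have h₁ := hw'.comp_tendsto hlim
    have h₂ := (isBigO_refl c l).smul_isLittleO h₁
    have h₃ : (fun n => c n • (inner ℝ (Φ (x + δ n) - Φ x) w' - B (x + δ n - x) v')) =o[l]
        fun _ => (1 : ℝ) := by
      refine h₂.trans_isBigO (hcδ.isBigO_one ℝ |>.congr_left fun n => ?_)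
      simp
    have h₄ : Tendsto (fun n => inner ℝ (u n) w' - B (c n • δ n) v') l
        (𝓝 (inner ℝ w w' - B v v')) :=
      (hw.inner tendsto_const_nhds).sub (((B.flip v').continuous.tendsto v).comp hcδ)
    have h₅ := tendsto_nhds_unique h₄ (((isLittleO_one_iff ℝ).1 h₃).congr fun n => by
      simp [hu, inner_smul_left]; ring)
    linarith

/-- A map into a Hilbert space is differentiable within `X` at `x` if the inner products of its
increments at `x` are bilinear to leading order and the tangent directions of `X` at `x` span. -/
theorem differentiableWithinAt_of_inner_isLittleO [FiniteDimensional ℝ E] [CompleteSpace H]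
    (hX : UniqueDiffWithinAt ℝ X x)
    (hΦ : (fun z : E × E => inner ℝ (Φ z.1 - Φ x) (Φ z.2 - Φ x) - B (z.1 - x) (z.2 - x))
        =o[𝓝[X] x ×ˢ 𝓝[X] x] fun z => ‖z.1 - x‖ * ‖z.2 - x‖) :
    DifferentiableWithinAt ℝ Φ X x := by
  have hspan : ⊤ ≤ Submodule.span ℝ (tangentConeAt ℝ X x) := by
    have := (Submodule.dense_iff_topologicalClosure_eq_top.1 hX.dense_tangentConeAt)
    rw [← this, (Submodule.closed_of_finiteDimensional _).submodule_topologicalClosure_eq]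
  let b := Module.Basis.ofSpan hspan
  have hb : ∀ i, b i ∈ tangentConeAt ℝ X x := fun i =>
    Module.Basis.ofSpan_subset hspan ⟨i, rfl⟩
  have := FiniteDimensional.fintypeBasisIndex b
  choose w hw hww using fun i => exists_inner_isLittleO_of_mem_tangentConeAt hΦ (hb i)
  let L : E →L[ℝ] H := (b.constr ℝ w).toContinuousLinearMap
  have hLb : ∀ i, L (b i) = w i := fun i => b.constr_basis ℝ w i
  have hLL : ∀ u v, inner ℝ (L u) (L v) = B u v := by
    intro u v
    rw [← b.sum_repr u, ← b.sum_repr v]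
    simp only [map_sum, map_smul, sum_inner, inner_sum, inner_smul_left, inner_smul_right, hLb,
      sum_apply, smul_apply, hww _ _ _ (hw _)]
    simp
  have hcross : (fun y => inner ℝ (Φ y - Φ x) (L (y - x)) - B (y - x) (y - x)) =o[𝓝[X] x]
      fun y => ‖y - x‖ * ‖y - x‖ := by
    have hsum : (fun y => ∑ i, b.repr (y - x) i *
        (inner ℝ (Φ y - Φ x) (w i) - B (y - x) (b i))) =o[𝓝[X] x]
        fun y => ‖y - x‖ * ‖y - x‖ := by
      refine IsLittleO.fun_sum fun i _ => IsBigO.mul_isLittleO ?_ (hw i).norm_right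
      exact ((b.coord i).toContinuousLinearMap.isBigO_comp (fun y => y - x) _).norm_right
    refine hsum.congr_left fun y => ?_
    have hL : L (y - x) = ∑ i, b.repr (y - x) i • w i := by
      conv_lhs => rw [← b.sum_repr (y - x)]
      simp only [map_sum, map_smul, hLb]
    have hB : B (y - x) (y - x) = ∑ i, b.repr (y - x) i * B (y - x) (b i) := by
      conv_lhs => enter [2]; rw [← b.sum_repr (y - x)]
      simp only [map_sum, map_smul, smul_eq_mul]
    rw [hL, hB]
    simp only [inner_sum, inner_smul_right, mul_sub, Finset.sum_sub_distrib]
  have hdiag : Tendsto (fun y => (y, y)) (𝓝[X] x) (𝓝[X] x ×ˢ 𝓝[X] x) :=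
    tendsto_id.prodMk tendsto_id
  -- `‖Φ y - Φ x - L h‖² = (⟪Φ y - Φ x, Φ y - Φ x⟫ - B h h) - 2 (⟪Φ y - Φ x, L h⟫ - B h h)`,
  -- where `h = y - x`, because `⟪L h, L h⟫ = B h h`.
  have hsq := (hΦ.comp_tendsto hdiag).sub (hcross.const_mul_left 2)
  refine ⟨L, HasFDerivWithinAt.of_isLittleO ?_⟩
  refine IsLittleO.of_norm_norm (IsLittleO.of_pow (n := 2) ?_ two_ne_zero)
  refine hsq.congr (fun y => ?_) fun y => ?_
  · simp only [Function.comp, Pi.pow_apply]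
    rw [norm_sub_sq_real (Φ y - Φ x), ← real_inner_self_eq_norm_sq, ← real_inner_self_eq_norm_sq,
      hLL]
    ring
  · simp [sq]

end Differentiability

/-! ### Stein features and the Stein kernel -/

section FeatureMap

variable {d : ℕ} {X : Set (EuclideanSpace ℝ (Fin d))}
  {H : Type*} [NormedAddCommGroup H] [InnerProductSpace ℝ H]
  {Φ : EuclideanSpace ℝ (Fin d) → H}
  {k : EuclideanSpace ℝ (Fin d) → EuclideanSpace ℝ (Fin d) → ℝ}

theorem SmoothOn.contDiffWithinAt {V : Type*} [NormedAddCommGroup V] [NormedSpace ℝ V] {n : ℕ}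
    {f : V → ℝ} {s : Set V} (hf : SmoothOn n f s) {x : V} (hx : x ∈ s) :
    ContDiffWithinAt ℝ n f s x := by
  obtain ⟨U, -, hsU, g, hg, hfg⟩ := hf
  exact ((hg x (hsU hx)).mono hsU).congr (fun y hy => hfg hy) (hfg hx)

theorem SmoothOn.differentiableOn {V : Type*} [NormedAddCommGroup V] [NormedSpace ℝ V]
    {f : V → ℝ} {s : Set V} (hf : SmoothOn 1 f s) : DifferentiableOn ℝ f s :=
  fun _ hx => (hf.contDiffWithinAt hx).differentiableWithinAt (by norm_num)

/-- A feature map of a `C²` kernel is differentiable. -/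
theorem differentiableOn_of_inner_eq_smooth [CompleteSpace H] (hX : UniqueDiffOn ℝ X)
    (hk : SmoothOn 2
      (fun z : EuclideanSpace ℝ (Fin d) × EuclideanSpace ℝ (Fin d) => k z.1 z.2) (X ×ˢ X))
    (hΦ : ∀ x ∈ X, ∀ y ∈ X, inner ℝ (Φ x) (Φ y) = k x y) : DifferentiableOn ℝ Φ X := by
  intro x hx
  obtain ⟨U, hU, hXU, K, hK, hkK⟩ := hk
  obtain ⟨B, hB⟩ := exists_isLittleO_mixedDifference
    ((hK (x, x) (hXU ⟨hx, hx⟩)).contDiffAt (hU.mem_nhds (hXU ⟨hx, hx⟩)))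
  refine differentiableWithinAt_of_inner_isLittleO (B := B) (hX x hx) ?_
  have hle : 𝓝[X] x ×ˢ 𝓝[X] x ≤ 𝓝 (x, x) := by
    rw [nhds_prod_eq]
    exact Filter.prod_mono nhdsWithin_le_nhds nhdsWithin_le_nhds
  refine (hB.mono hle).congr' ?_ EventuallyEq.rfl
  filter_upwards [prod_mem_prod (self_mem_nhdsWithin (s := X) (a := x)) self_mem_nhdsWithin]
    with ⟨y, z⟩ hyz
  have hKk : ∀ a ∈ X, ∀ b ∈ X, K (a, b) = inner ℝ (Φ a) (Φ b) := fun a ha b hb =>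
    (hkK (x := (a, b)) ⟨ha, hb⟩).symm.trans (hΦ a ha b hb).symm
  simp only
  rw [hKk y hyz.1 z hyz.2, hKk y hyz.1 x hx, hKk x hx z hyz.2, hKk x hx x hx]
  simp only [inner_sub_left, inner_sub_right]
  ring

/-- The `i`-th coordinate of the Stein operator of `r` applied to the Hilbert space valued map `Φ`,
that is `s_{r,i} Φ + ∂ᵢ Φ`. -/
noncomputable def steinFeature (X : Set (EuclideanSpace ℝ (Fin d)))
    (r : EuclideanSpace ℝ (Fin d) → ℝ) (Φ : EuclideanSpace ℝ (Fin d) → H) (i : Fin d)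
    (x : EuclideanSpace ℝ (Fin d)) : H :=
  score X r x i • Φ x + fderivWithin ℝ Φ X x (EuclideanSpace.single i 1)

theorem gradientWithin_apply (f : EuclideanSpace ℝ (Fin d) → ℝ) (x : EuclideanSpace ℝ (Fin d))
    (i : Fin d) : gradientWithin f X x i = fderivWithin ℝ f X x (EuclideanSpace.single i 1) := by
  rw [← inner_gradientWithin_left, EuclideanSpace.inner_single_right]
  simp

theorem gradientWithin_inner_apply (hX : UniqueDiffOn ℝ X) (hΦ : DifferentiableOn ℝ Φ X) {c : H}
    {f : EuclideanSpace ℝ (Fin d) → ℝ} (hf : ∀ x ∈ X, f x = inner ℝ c (Φ x))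
    {x : EuclideanSpace ℝ (Fin d)} (hx : x ∈ X) (i : Fin d) :
    gradientWithin f X x i = inner ℝ c (fderivWithin ℝ Φ X x (EuclideanSpace.single i 1)) := by
  have h : HasFDerivWithinAt f (innerSL ℝ c ∘L fderivWithin ℝ Φ X x) X x :=
    ((innerSL ℝ c).hasFDerivAt.comp_hasFDerivWithinAt x (hΦ x hx).hasFDerivWithinAt).congr
      (fun y hy => hf y hy) (hf x hx)
  rw [gradientWithin_apply, h.fderivWithin (hX x hx)]
  simp

/-- The Stein operator commutes with pairing against a fixed vector. For `f = 0` it says that a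
vector orthogonal to all `Φ x` is orthogonal to all Stein features. -/
theorem steinOp_inner_apply (hX : UniqueDiffOn ℝ X) (hΦ : DifferentiableOn ℝ Φ X) {c : H}
    {f r : EuclideanSpace ℝ (Fin d) → ℝ} (hf : ∀ x ∈ X, f x = inner ℝ c (Φ x))
    {x : EuclideanSpace ℝ (Fin d)} (hx : x ∈ X) (i : Fin d) :
    steinOp X r f x i = inner ℝ c (steinFeature X r Φ i x) := by
  simp only [steinOp, steinFeature, PiLp.add_apply, PiLp.smul_apply, smul_eq_mul, inner_add_right,
    inner_smul_right, gradientWithin_inner_apply hX hΦ hf hx, hf x hx]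
  ring

theorem steinKernel_eq_sum_inner (hX : UniqueDiffOn ℝ X) (hΦ : DifferentiableOn ℝ Φ X)
    (hk : ∀ x ∈ X, ∀ y ∈ X, inner ℝ (Φ x) (Φ y) = k x y) (r : EuclideanSpace ℝ (Fin d) → ℝ)
    {x x' : EuclideanSpace ℝ (Fin d)} (hx : x ∈ X) (hx' : x' ∈ X) :
    steinKernel X r k x x'
      = ∑ i, inner ℝ (steinFeature X r Φ i x) (steinFeature X r Φ i x') := by
  have h₁ : ∀ y ∈ X, ∀ i, gradientWithin (fun y' => k y y') X x' i
      = inner ℝ (fderivWithin ℝ Φ X x' (EuclideanSpace.single i 1)) (Φ y) := fun y hy i => by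
    rw [gradientWithin_inner_apply hX hΦ (c := Φ y) (fun z hz => (hk y hy z hz).symm) hx',
      real_inner_comm]
  have h₂ : ∀ i, gradientWithin (fun y => k y x') X x i
      = inner ℝ (Φ x') (fderivWithin ℝ Φ X x (EuclideanSpace.single i 1)) := fun i =>
    gradientWithin_inner_apply hX hΦ
      (fun z hz => by rw [← hk z hz x' hx', real_inner_comm]) hx i
  have h₃ : ∀ i, gradientWithin (fun y => gradientWithin (fun y' => k y y') X x' i) X x i
      = inner ℝ (fderivWithin ℝ Φ X x' (EuclideanSpace.single i 1))
        (fderivWithin ℝ Φ X x (EuclideanSpace.single i 1)) := fun i =>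
    gradientWithin_inner_apply hX hΦ (fun z hz => h₁ z hz i) hx i
  simp only [steinKernel, PiLp.inner_apply]
  simp only [← Finset.sum_add_distrib]
  refine Finset.sum_congr rfl fun i _ => ?_
  simp only [PiLp.smul_apply, h₁ x hx, h₂, h₃, steinFeature, inner_add_left, inner_add_right,
    inner_smul_left, inner_smul_right, ← hk x hx x' hx']
  rw [real_inner_comm (Φ x) (fderivWithin ℝ Φ X x' _),
    real_inner_comm (Φ x') (fderivWithin ℝ Φ X x _),
    real_inner_comm (fderivWithin ℝ Φ X x _) (fderivWithin ℝ Φ X x' _)]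
  simp
  ring

theorem isPosDefKernel_of_eq_sum_inner {u : EuclideanSpace ℝ (Fin d) → EuclideanSpace ℝ (Fin d) → ℝ}
    {κ : Type*} [Fintype κ] {Ψ : κ → EuclideanSpace ℝ (Fin d) → H}
    (hu : ∀ x ∈ X, ∀ x' ∈ X, u x x' = ∑ i, inner ℝ (Ψ i x) (Ψ i x')) : IsPosDefKernel X u := by
  have h : (Matrix.of fun x x' : X => u x x')
      = Matrix.of fun x x' : X => ∑ i, inner ℝ (Ψ i x) (Ψ i x') := by
    ext x x'
    exact hu x x.2 x' x'.2
  refine ⟨?_, fun c => ?_⟩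
  · rw [h]
    ext x x'
    simp [Matrix.conjTranspose_apply, real_inner_comm]
  · have : c.sum (fun x cx => c.sum fun x' cx' => star cx *
        (Matrix.of fun x x' : X => u x x') x x' * cx')
        = ∑ i, inner ℝ (c.sum fun x cx => cx • Ψ i x) (c.sum fun x cx => cx • Ψ i x) := by
      rw [h]
      simp only [Finsupp.sum, sum_inner, inner_sum, inner_smul_left, inner_smul_right,
        Matrix.of_apply]
      rw [Finset.sum_comm (s := Finset.univ)]
      refine Finset.sum_congr rfl fun a _ => ?_
      simp only [Finset.mul_sum (s := c.support)]
      rw [Finset.sum_comm (s := Finset.univ)]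
      refine Finset.sum_congr rfl fun b _ => ?_
      rw [Finset.mul_sum, Finset.sum_mul]
      refine Finset.sum_congr rfl fun i _ => ?_
      rw [real_inner_comm (Ψ i a)]
      simp only [star_trivial, conj_trivial]
      ring
    rw [this]
    exact Finset.sum_nonneg fun i _ => real_inner_self_nonneg

end FeatureMap

section SpectralFeatureMap

variable {d : ℕ} {ι : Type*} {X : Set (EuclideanSpace ℝ (Fin d))}
  {k : EuclideanSpace ℝ (Fin d) → EuclideanSpace ℝ (Fin d) → ℝ}
  {lam : ι → ℝ} {e : ι → EuclideanSpace ℝ (Fin d) → ℝ}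

/-- A square summable family of reals is (the coordinate family of) an element of `ℓ²`. -/
theorem exists_lp_two_of_summable_sq {a : ι → ℝ} (ha : Summable fun j => a j ^ 2) :
    ∃ c : lp (fun _ : ι => ℝ) 2, ∀ j, c j = a j :=
  ⟨⟨a, memℓp_gen (by simpa using ha)⟩, fun _ => rfl⟩

/-- The feature map `x ↦ (√(lam j) * e j x)ⱼ ∈ ℓ²` of a kernel. Its values outside `X`, where the
family need not be square summable, are immaterial. -/
theorem IsSpectralDecomposition.exists_feature (hdec : IsSpectralDecomposition X k lam e) :
    ∃ Φ : EuclideanSpace ℝ (Fin d) → lp (fun _ : ι => ℝ) 2,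
      (∀ x ∈ X, ∀ j, Φ x j = √(lam j) * e j x) ∧
      ∀ x ∈ X, ∀ y ∈ X, inner ℝ (Φ x) (Φ y) = k x y := by
  have hex : ∀ x, ∃ c : lp (fun _ : ι => ℝ) 2, x ∈ X → ∀ j, c j = √(lam j) * e j x := by
    intro x
    by_cases hx : x ∈ X
    · obtain ⟨c, hc⟩ := exists_lp_two_of_summable_sq (a := fun j => √(lam j) * e j x)
        ((hdec.expansion x hx x hx).summable.congr fun j => by
          rw [mul_pow, Real.sq_sqrt (hdec.pos j).le]; ring)
      exact ⟨c, fun _ => hc⟩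
    · exact ⟨0, fun h => absurd h hx⟩
  choose Φ hΦ using hex
  refine ⟨Φ, hΦ, fun x hx y hy => ?_⟩
  refine (lp.hasSum_inner (𝕜 := ℝ) (Φ x) (Φ y)).unique (?_)
  refine (hdec.expansion x hx y hy).congr_fun fun j => ?_
  rw [hΦ x hx, hΦ y hy]
  have := Real.mul_self_sqrt (hdec.pos j).le
  simp only [RCLike.inner_apply, conj_trivial]
  linear_combination (e j x * e j y) * this

theorem eigenfunction_eq_inner_single [DecidableEq ι]
    {Φ : EuclideanSpace ℝ (Fin d) → lp (fun _ : ι => ℝ) 2}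
    (hlam : ∀ j, 0 < lam j) (hΦ : ∀ x ∈ X, ∀ j, Φ x j = √(lam j) * e j x) (j : ι) :
    ∀ x ∈ X, e j x = inner ℝ (lp.single 2 j (√(lam j))⁻¹) (Φ x) := by
  intro x hx
  have : √(lam j) ≠ 0 := (Real.sqrt_pos.2 (hlam j)).ne'
  rw [lp.inner_single_left, hΦ x hx]
  simp
  field_simp

theorem steinFeature_apply (hX : UniqueDiffOn ℝ X)
    {Φ : EuclideanSpace ℝ (Fin d) → lp (fun _ : ι => ℝ) 2} (hd : DifferentiableOn ℝ Φ X)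
    (hlam : ∀ j, 0 < lam j) (hΦ : ∀ x ∈ X, ∀ j, Φ x j = √(lam j) * e j x)
    (r : EuclideanSpace ℝ (Fin d) → ℝ) {x : EuclideanSpace ℝ (Fin d)} (hx : x ∈ X) (i : Fin d)
    (j : ι) : steinFeature X r Φ i x j = √(lam j) * steinOp X r (e j) x i := by
  classical
  have : √(lam j) ≠ 0 := (Real.sqrt_pos.2 (hlam j)).ne'
  rw [steinOp_inner_apply hX hd (eigenfunction_eq_inner_single hlam hΦ j) hx, lp.inner_single_left]
  simp
  field_simp

end SpectralFeatureMap

/-! ### Term-by-term integration -/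

section Series

/-- Term-by-term integration of a series that converges absolutely in `L¹`, including integrability
of its pointwise sum. -/
theorem integrable_and_hasSum_integral {Ω ι : Type*} [MeasurableSpace Ω] [Countable ι]
    {μ : Measure Ω} {F : ι → Ω → ℝ} {G : Ω → ℝ} (hF : ∀ j, Integrable (F j) μ)
    (hsum : Summable fun j => ∫ a, ‖F j a‖ ∂μ)
    (hG : ∀ᵐ a ∂μ, HasSum (fun j => F j a) (G a)) :
    Integrable G μ ∧ HasSum (fun j => ∫ a, F j a ∂μ) (∫ a, G a ∂μ) := by
  have hGt : (fun a => ∑' j, F j a) =ᵐ[μ] G := hG.mono fun a ha => ha.tsum_eq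
  refine ⟨⟨?_, ?_⟩, ?_⟩
  · refine aestronglyMeasurable_of_tendsto_ae (u := (atTop : Filter (Finset ι)))
      (f := fun s a => ∑ j ∈ s, F j a) (fun s => ?_) hG
    exact (integrable_finsetSum s fun j _ => hF j).aestronglyMeasurable
  · have hle : ∫⁻ a, ‖G a‖ₑ ∂μ ≤ ∑' j, ∫⁻ a, ‖F j a‖ₑ ∂μ := by
      rw [← lintegral_tsum fun j => (hF j).aestronglyMeasurable.enorm]
      refine lintegral_mono_ae (hG.mono fun a ha => ?_)
      rw [← ha.tsum_eq]
      exact enorm_tsum_le_tsum_enorm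
    refine hle.trans_lt ?_
    have : ∀ j, ∫⁻ a, ‖F j a‖ₑ ∂μ = ENNReal.ofReal (∫ a, ‖F j a‖ ∂μ) := fun j =>
      (ofReal_integral_norm_eq_lintegral_enorm (hF j)).symm
    simp only [this]
    rw [← ENNReal.ofReal_tsum_of_nonneg (fun j => integral_nonneg fun a => norm_nonneg _) hsum]
    exact ENNReal.ofReal_lt_top
  · rw [← integral_congr_ae hGt]
    exact hasSum_integral_of_summable_integral_norm hF hsum

theorem integrable_inner_prod {Ω V : Type*} [MeasurableSpace Ω] [NormedAddCommGroup V]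
    [InnerProductSpace ℝ V] {μ : Measure Ω} [SFinite μ] {f : Ω → V} (hf : Integrable f μ) :
    Integrable (fun z : Ω × Ω => inner ℝ (f z.1) (f z.2)) (μ.prod μ) := by
  refine (hf.norm.mul_prod hf.norm).mono' ?_ (.of_forall fun z => norm_inner_le_norm _ _)
  exact hf.aestronglyMeasurable.comp_fst.inner hf.aestronglyMeasurable.comp_snd

theorem integral_inner_prod {Ω V : Type*} [MeasurableSpace Ω] [NormedAddCommGroup V]
    [InnerProductSpace ℝ V] [CompleteSpace V] {μ : Measure Ω} [SFinite μ] {f : Ω → V}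
    (hf : Integrable f μ) :
    ∫ z : Ω × Ω, inner ℝ (f z.1) (f z.2) ∂(μ.prod μ) = ‖∫ x, f x ∂μ‖ ^ 2 := by
  rw [integral_prod _ (integrable_inner_prod hf)]
  have h : ∀ x, ∫ y, inner ℝ (f x) (f y) ∂μ = inner ℝ (∫ y, f y ∂μ) (f x) := fun x => by
    rw [integral_inner hf, real_inner_comm]
  simp only [h]
  rw [integral_inner hf, real_inner_self_eq_norm_sq]

/-- Term-by-term integration, over independent `x, y ∼ μ`, of `∑ⱼ lam j * ⟪f j x, f j y⟫`. -/
theorem integrable_and_hasSum_integral_inner_prod {Ω ι V : Type*} [MeasurableSpace Ω] [Countable ι]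
    [NormedAddCommGroup V] [InnerProductSpace ℝ V] [CompleteSpace V] {μ : Measure Ω} [SFinite μ]
    {lam : ι → ℝ} (hlam : ∀ j, 0 ≤ lam j) {f : ι → Ω → V} {G : Ω × Ω → ℝ}
    (hf : ∀ j, Integrable (f j) μ) (hsum : Summable fun j => lam j * (∫ x, ‖f j x‖ ∂μ) ^ 2)
    (hG : ∀ᵐ z ∂(μ.prod μ), HasSum (fun j => lam j * inner ℝ (f j z.1) (f j z.2)) (G z)) :
    Integrable G (μ.prod μ) ∧
      HasSum (fun j => lam j * ‖∫ x, f j x ∂μ‖ ^ 2) (∫ z, G z ∂(μ.prod μ)) := by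
  have h := integrable_and_hasSum_integral (fun j => (integrable_inner_prod (hf j)).const_mul _)
    (hsum.of_nonneg_of_le (fun j => integral_nonneg fun z => norm_nonneg _) fun j => ?_) hG
  · refine ⟨h.1, h.2.congr_fun fun j => ?_⟩
    rw [integral_const_mul, integral_inner_prod (hf j)]
  · simp only [norm_mul, Real.norm_of_nonneg (hlam j)]
    rw [integral_const_mul, sq, ← integral_prod_mul]
    refine mul_le_mul_of_nonneg_left ?_ (hlam j)
    exact integral_mono (integrable_inner_prod (hf j)).norm
      ((hf j).norm.mul_prod (hf j).norm) fun z => norm_inner_le_norm _ _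

end Series

/-! ### Expectations of the Stein operator -/

section Law

variable {d : ℕ} {X : Set (EuclideanSpace ℝ (Fin d))} {p q : EuclideanSpace ℝ (Fin d) → ℝ}

instance : SFinite (law X p) := by
  unfold law
  infer_instance

theorem ae_law_mem (hX : MeasurableSet X) : ∀ᵐ x ∂law X p, x ∈ X :=
  (withDensity_absolutelyContinuous _ _).ae_le (ae_restrict_mem hX)

theorem aemeasurable_density (hX : MeasurableSet X) (hp : SmoothOn 1 p X) :
    AEMeasurable (fun x => ENNReal.ofReal (p x)) (volume.restrict X) :=
  (hp.differentiableOn.continuousOn.aemeasurable hX).ennreal_ofReal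

theorem integral_law {V : Type*} [NormedAddCommGroup V] [NormedSpace ℝ V] (hX : MeasurableSet X)
    (hp : IsSmoothDensity X p) (g : EuclideanSpace ℝ (Fin d) → V) :
    ∫ x, g x ∂law X p = ∫ x in X, p x • g x := by
  rw [law, integral_withDensity_eq_integral_toReal_smul₀ (aemeasurable_density hX hp.smooth)
    (.of_forall fun x => ENNReal.ofReal_lt_top)]
  refine setIntegral_congr_fun hX fun x hx => ?_
  simp only [ENNReal.toReal_ofReal (hp.pos x hx).le]

/-- `p A_p f = ∇(f p)`. -/
theorem smul_steinOp (hX : IsDomainSet X) (hp : IsSmoothDensity X p)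
    {f : EuclideanSpace ℝ (Fin d) → ℝ} (hf : DifferentiableOn ℝ f X)
    {x : EuclideanSpace ℝ (Fin d)} (hx : x ∈ X) :
    p x • steinOp X p f x = gradientWithin (fun x => f x * p x) X x := by
  have hpx := (hp.pos x hx).ne'
  ext i
  rw [gradientWithin_apply, fderivWithin_fun_mul (hX.uniqueDiffOn x hx) (hf x hx)
    (hp.smooth.differentiableOn x hx)]
  simp [steinOp, score, gradientWithin_apply]
  field_simp

/-- Stein's identity for functions in the Stein class. -/
theorem integral_steinOp_apply_eq_zero (hX : IsDomainSet X) (hp : IsSmoothDensity X p)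
    {f : EuclideanSpace ℝ (Fin d) → ℝ} (hf : InSteinClass X p f) (i : Fin d) :
    ∫ x, steinOp X p f x i ∂law X p = 0 := by
  have h : ∀ x ∈ X, p x • steinOp X p f x i
      = EuclideanSpace.proj (𝕜 := ℝ) i (gradientWithin (fun x => f x * p x) X x) := fun x hx => by
    rw [← smul_steinOp hX hp hf.smooth.differentiableOn hx]
    simp
  rw [integral_law hX.measurableSet hp, setIntegral_congr_fun hX.measurableSet h,
    ContinuousLinearMap.integral_comp_comm _ hf.integrableOn, hf.integral_eq_zero, map_zero]

theorem steinOp_sub_steinOp (f : EuclideanSpace ℝ (Fin d) → ℝ) (x : EuclideanSpace ℝ (Fin d)) :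
    steinOp X q f x - steinOp X p f x = f x • (score X q x - score X p x) := by
  simp [steinOp, smul_sub]

end Law

/-! ### Stein's identity for the eigenfunctions -/

section SteinIdentity

variable {d : ℕ} {ι : Type*} {X : Set (EuclideanSpace ℝ (Fin d))}
  {p : EuclideanSpace ℝ (Fin d) → ℝ}
  {k : EuclideanSpace ℝ (Fin d) → EuclideanSpace ℝ (Fin d) → ℝ}
  {lam : ι → ℝ} {e : ι → EuclideanSpace ℝ (Fin d) → ℝ}

theorem SteinSummable.integrable_apply (hs : SteinSummable X p p lam e) (i : Fin d) (j : ι) :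
    Integrable (fun x => steinOp X p (e j) x i) (law X p) :=
  (EuclideanSpace.proj (𝕜 := ℝ) i).integrable_comp (hs.integrable j)

theorem SteinSummable.integral_norm_apply_le (hs : SteinSummable X p p lam e) (i : Fin d) (j : ι) :
    ∫ x, ‖steinOp X p (e j) x i‖ ∂law X p ≤ ∫ x, ‖steinOp X p (e j) x‖ ∂law X p :=
  integral_mono (hs.integrable_apply i j).norm (hs.integrable j).norm
    fun _ => PiLp.norm_apply_le _ i

/-- Stein's identity for the eigenfunctions. They are not assumed to be in the Stein class of `p`;
the identity follows from the kernel being in it, since the functions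
`∑ⱼ lam j * E_p[A_p e_j]ᵢ * e j`, which vanish on `X`, can be differentiated and integrated term by
term. -/
theorem integral_steinOp_eigenfunction_eq_zero [Countable ι] (hX : IsDomainSet X)
    (hp : IsSmoothDensity X p) (hkp : KernelInSteinClass X p k)
    (hdec : IsSpectralDecomposition X k lam e) (hs : SteinSummable X p p lam e) (j : ι) :
    ∫ x, steinOp X p (e j) x ∂law X p = 0 := by
  obtain ⟨Φ, hΦ, hΦk⟩ := hdec.exists_feature
  have hd := differentiableOn_of_inner_eq_smooth hX.uniqueDiffOn hkp.smooth hΦk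
  have hae : ∀ᵐ x ∂law X p, x ∈ X := ae_law_mem hX.measurableSet
  have hM : ∀ j, 0 ≤ ∫ x, ‖steinOp X p (e j) x‖ ∂law X p := fun j =>
    integral_nonneg fun _ => norm_nonneg _
  set M : ι → ℝ := fun j => ∫ x, ‖steinOp X p (e j) x‖ ∂law X p
  ext i
  set m : ι → ℝ := fun j => ∫ x, steinOp X p (e j) x i ∂law X p
  have hmM : ∀ j, ‖m j‖ ≤ M j := fun j =>
    (norm_integral_le_integral_norm _).trans (hs.integral_norm_apply_le i j)
  have hmsum : Summable fun j => lam j * m j ^ 2 :=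
    hs.summable.of_nonneg_of_le (fun j => mul_nonneg (hdec.pos j).le (sq_nonneg _)) fun j =>
      mul_le_mul_of_nonneg_left (sq_le_sq' (neg_le_of_abs_le (hmM j)) (le_of_abs_le (hmM j)))
        (hdec.pos j).le
  have hmul : ∀ j, √(lam j) * √(lam j) = lam j := fun j => Real.mul_self_sqrt (hdec.pos j).le
  obtain ⟨c, hc⟩ := exists_lp_two_of_summable_sq (a := fun j => √(lam j) * m j)
    (hmsum.congr fun j => by rw [mul_pow, Real.sq_sqrt (hdec.pos j).le])
  -- Each `⟪a, Ψᵢ ·⟫` integrates term by term. It is used for `a = Φ x'` and for `a = c`.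
  have key : ∀ a : lp (fun _ : ι => ℝ) 2, (Summable fun j => √(lam j) * |a j| * M j) →
      HasSum (fun j => √(lam j) * a j * m j)
        (∫ x, inner ℝ a (steinFeature X p Φ i x) ∂law X p) := by
    intro a ha
    have h := (integrable_and_hasSum_integral (μ := law X p)
      (F := fun j x => √(lam j) * a j * steinOp X p (e j) x i)
      (G := fun x => inner ℝ a (steinFeature X p Φ i x))
      (fun j => (hs.integrable_apply i j).const_mul _) ?_ ?_).2
    · simpa only [integral_const_mul] using h
    · refine ha.of_nonneg_of_le (fun j => integral_nonneg fun _ => norm_nonneg _) fun j => ?_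
      simp only [norm_mul, integral_const_mul, Real.norm_eq_abs, abs_of_nonneg (Real.sqrt_nonneg _)]
      exact mul_le_mul_of_nonneg_left (hs.integral_norm_apply_le i j) (by positivity)
    · filter_upwards [hae] with x hx
      refine (lp.hasSum_inner (𝕜 := ℝ) a _).congr_fun fun j => ?_
      rw [steinFeature_apply hX.uniqueDiffOn hd hdec.pos hΦ p hx]
      simp only [RCLike.inner_apply, conj_trivial]
      ring
  -- `2 √(lam j) |a j| M j ≤ a j ^ 2 + lam j * M j ^ 2`
  have hsummable : ∀ a : lp (fun _ : ι => ℝ) 2, Summable fun j => √(lam j) * |a j| * M j := by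
    intro a
    have ha : Summable fun j => a j ^ 2 :=
      ((lp.hasSum_inner (𝕜 := ℝ) a a).summable).congr fun j => by simp [sq]
    refine (ha.add hs.summable).of_nonneg_of_le
      (fun j => mul_nonneg (by positivity) (hM j)) fun j => ?_
    have := hmul j
    nlinarith [sq_nonneg (|a j| - √(lam j) * M j), sq_abs (a j), sq_nonneg (a j),
      mul_nonneg (hdec.pos j).le (sq_nonneg (M j))]
  -- Stein's identity for `k(x', ·)`, expanded in eigenfunctions.
  have horth : ∀ x ∈ X, inner ℝ c (Φ x) = (0 : ℝ) := by
    intro x' hx'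
    have h₀ : ∫ x, inner ℝ (Φ x') (steinFeature X p Φ i x) ∂law X p = (0 : ℝ) := by
      rw [← integral_steinOp_apply_eq_zero hX hp (hkp.left x' hx') i]
      refine integral_congr_ae (hae.mono fun x hx => ?_)
      exact (steinOp_inner_apply hX.uniqueDiffOn hd
        (fun y hy => (hΦk x' hx' y hy).symm) hx i).symm
    have h₁ := key (Φ x') (hsummable _)
    rw [h₀] at h₁
    refine (lp.hasSum_inner (𝕜 := ℝ) c (Φ x')).unique (h₁.congr_fun fun j => ?_)
    rw [hc]
    simp only [RCLike.inner_apply, conj_trivial]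
    ring
  have h₀ : ∫ x, inner ℝ c (steinFeature X p Φ i x) ∂law X p = (0 : ℝ) := by
    refine (integral_congr_ae (hae.mono fun x hx => ?_)).trans (integral_zero _ ℝ)
    rw [← steinOp_inner_apply hX.uniqueDiffOn hd (f := fun _ => 0)
      (fun y hy => (horth y hy).symm) hx i]
    simp [steinOp, gradientWithin_apply]
  have hfinal := key c (hsummable c)
  rw [h₀] at hfinal
  have hzero : lam j * m j ^ 2 = 0 := by
    have h := (hasSum_zero_iff_of_nonneg fun j => ?_).1 (hfinal.congr_fun
      (g := fun j => lam j * m j ^ 2) fun j => ?_)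
    · exact congrFun h j
    · exact mul_nonneg (hdec.pos j).le (sq_nonneg _)
    · rw [hc]
      linear_combination (-m j ^ 2) * hmul j
  have hmj : m j = 0 := by simpa [(hdec.pos j).ne'] using hzero
  have hcomm := (EuclideanSpace.proj (𝕜 := ℝ) i).integral_comp_comm (hs.integrable j)
  simpa using hcomm.symm.trans hmj

end SteinIdentity

end KernelStein

theorem mainTheorem5 {d : ℕ} {ι : Type*} [Countable ι]
    (X : Set (EuclideanSpace ℝ (Fin d))) (hX : KernelStein.IsDomainSet X)
    (p q : EuclideanSpace ℝ (Fin d) → ℝ)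
    (hp : KernelStein.IsSmoothDensity X p) (hq : KernelStein.IsSmoothDensity X q)
    (k : EuclideanSpace ℝ (Fin d) → EuclideanSpace ℝ (Fin d) → ℝ)
    (hk : KernelStein.IsPosDefKernel X k) (hkp : KernelStein.KernelInSteinClass X p k)
    (lam : ι → ℝ) (e : ι → EuclideanSpace ℝ (Fin d) → ℝ)
    (hdec : KernelStein.IsSpectralDecomposition X k lam e) :
    (∀ j, DifferentiableOn ℝ (e j) X) ∧
    (∀ x ∈ X, ∀ x' ∈ X,
      HasSum (fun j => lam j *
          inner ℝ (KernelStein.steinOp X q (e j) x) (KernelStein.steinOp X q (e j) x'))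
        (KernelStein.steinKernel X q k x x')) ∧
    KernelStein.IsPosDefKernel X (KernelStein.steinKernel X q k) ∧
    (KernelStein.SteinSummable X p p lam e → KernelStein.SteinSummable X p q lam e →
      Integrable (KernelStein.ksdIntegrand X p q k)
          ((KernelStein.law X p).prod (KernelStein.law X p)) ∧
      HasSum (fun j => lam j *
          ‖∫ x, KernelStein.steinOp X q (e j) x ∂(KernelStein.law X p)‖ ^ 2)
        (KernelStein.ksd X p q k)) := by
  classical
  obtain ⟨Φ, hΦ, hΦk⟩ := hdec.exists_feature
  have hd := KernelStein.differentiableOn_of_inner_eq_smooth hX.uniqueDiffOn hkp.smooth hΦk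
  have hkernel : ∀ x ∈ X, ∀ x' ∈ X, KernelStein.steinKernel X q k x x' = _ := fun x hx x' hx' =>
    KernelStein.steinKernel_eq_sum_inner hX.uniqueDiffOn hd hΦk q hx hx'
  refine ⟨fun j => ?_, fun x hx x' hx' => ?_,
    KernelStein.isPosDefKernel_of_eq_sum_inner hkernel, fun hsp hsq => ?_⟩
  · exact ((differentiableOn_const _).inner ℝ hd).congr
      (KernelStein.eigenfunction_eq_inner_single hdec.pos hΦ j)
  · rw [hkernel x hx x' hx']
    refine (hasSum_sum fun i _ => lp.hasSum_inner (𝕜 := ℝ) _ _).congr_fun fun j => ?_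
    have := Real.mul_self_sqrt (hdec.pos j).le
    simp only [KernelStein.steinFeature_apply hX.uniqueDiffOn hd hdec.pos hΦ q hx,
      KernelStein.steinFeature_apply hX.uniqueDiffOn hd hdec.pos hΦ q hx', PiLp.inner_apply,
      RCLike.inner_apply, conj_trivial, Finset.mul_sum]
    refine Finset.sum_congr rfl fun i _ => ?_
    linear_combination (-(KernelStein.steinOp X q (e j) x i) * KernelStein.steinOp X q (e j) x' i)
      * this
  · have hint : ∀ j, Integrable (fun x => KernelStein.steinOp X q (e j) x
        - KernelStein.steinOp X p (e j) x) (KernelStein.law X p) := fun j =>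
      (hsq.integrable j).sub (hsp.integrable j)
    have hae : ∀ᵐ x ∂KernelStein.law X p, x ∈ X := KernelStein.ae_law_mem hX.measurableSet
    have hprod : ∀ᵐ z ∂(KernelStein.law X p).prod (KernelStein.law X p), z.1 ∈ X ∧ z.2 ∈ X :=
      (Measure.quasiMeasurePreserving_fst.ae hae).and (Measure.quasiMeasurePreserving_snd.ae hae)
    have h := KernelStein.integrable_and_hasSum_integral_inner_prod (fun j => (hdec.pos j).le)
      (G := KernelStein.ksdIntegrand X p q k) hint ?_ ?_
    · refine ⟨h.1, h.2.congr_fun fun j => ?_⟩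
      rw [integral_sub (hsq.integrable j) (hsp.integrable j),
        KernelStein.integral_steinOp_eigenfunction_eq_zero hX hp hkp hdec hsp j, sub_zero]
    · refine ((hsp.summable.add hsq.summable).mul_left 2).of_nonneg_of_le
        (fun j => mul_nonneg (hdec.pos j).le (sq_nonneg _)) fun j => ?_
      have hle : ∫ x, ‖KernelStein.steinOp X q (e j) x - KernelStein.steinOp X p (e j) x‖
            ∂KernelStein.law X p
          ≤ ∫ x, ‖KernelStein.steinOp X q (e j) x‖ ∂KernelStein.law X p
            + ∫ x, ‖KernelStein.steinOp X p (e j) x‖ ∂KernelStein.law X p := by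
        rw [← integral_add (hsq.integrable j).norm (hsp.integrable j).norm]
        exact integral_mono (hint j).norm ((hsq.integrable j).norm.add (hsp.integrable j).norm)
          fun x => norm_sub_le _ _
      have h₀ : 0 ≤ ∫ x, ‖KernelStein.steinOp X q (e j) x - KernelStein.steinOp X p (e j) x‖
          ∂KernelStein.law X p := integral_nonneg fun x => norm_nonneg _
      have h₂ := (pow_le_pow_left₀ h₀ hle 2).trans (add_sq_le)
      refine (mul_le_mul_of_nonneg_left h₂ (hdec.pos j).le).trans_eq ?_
      ring
    · filter_upwards [hprod] with z hz
      simp only [KernelStein.ksdIntegrand, inner_smul_right]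
      refine ((hdec.expansion _ hz.1 _ hz.2).mul_right _).congr_fun fun j => ?_
      rw [KernelStein.steinOp_sub_steinOp, KernelStein.steinOp_sub_steinOp, inner_smul_left,
        inner_smul_right]
      simp only [conj_trivial]
      ring
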